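/- Let $X$ be a finite metric space and let $\Bbbk$ be a field. For $x_0,\dots,x_k\in X$ put $\ell(x_0,\dots,x_k)=\sum_{i=1}^{k}d(x_{i-1},x_i)$. For $l\in\mathbb R$ let $\mathrm{BMC}_k(X)(l)$ be the $\Bbbk$-vector space with basis the tuples $(x_0,\dots,x_k)\in X^{k+1}$ such that $x_{i-1}\neq x_i$ for all $i$ and $\ell(x_0,\dots,x_k)\le l$. With the boundary operators $\partial(x_0,\dots,x_k)=\sum_{i=0}^{k}(-1)^i(x_0,\dots,\widehat{x_i},\dots,x_k)$, in which a tuple with two equal consecutive entries is read as $0$, and with the inclusions $\mathrm{BMC}_k(X)(l)\subseteq \mathrm{BMC}_k(X)(l')$ for $l\le l'$, these spaces form a chain complex of persistence modules (functors from $(\mathbb R,\le)$ to $\Bbbk$-vector spaces). Its homology $\mathrm{BMH}_*(X)$ is the blurred magnitude homology of $X$. Suppose that for every $k\ge 0$ the persistence module $\mathrm{BMH}_k(X)$ has barcode consisting of the bars $[a_{k,i},b_{k,i})$, $i\in I_k$, where $-\infty<a_{k,i}<b_{k,i}\le\infty$; that is, $\mathrm{BMH}_k(X)\cong\bigoplus_{i\in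 I_k}\Bbbk[a_{k,i},b_{k,i})$, where $\Bbbk[a,b)$ denotes the interval module. Then each $I_k$ is finite, and for all sufficiently large $t>0$ (how large depending only on $X$ and $\Bbbk$) the magnitude $|tX|$ is defined, the following series converges absolutely, and $$|tX|=\sum_{k=0}^{\infty}\sum_{i\in I_k}(-1)^k\left(e^{-a_{k,i}t}-e^{-b_{k,i}t}\right),\qquad e^{-\infty}=0 .$$ Here $tX$ is $X$ with all distances multiplied by $t$. The magnitude $|tX|$ is defined if there is a weighting, i.e. a function $w\colon X\to\mathbb R$ with $\sum_{y\in X}e^{-t\,d(x,y)}w(y)=1$ for all $x\in X$; it is then $\sum_{x\in X}w(x)$, which does not depend on the choice of $w$. -/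

import Mathlib

open CategoryTheory

universe u v w w₁ w₂

noncomputable section

namespace BlurredMagnitude

/-! ### Magnitude of finite metric spaces -/

/-- `w` is a weighting for the distance function `d` on the finite set `X`. -/
def IsWeighting {X : Type u} [Fintype X] (d : X → X → ℝ) (w : X → ℝ) : Prop :=
  ∀ x, ∑ y, Real.exp (-d x y) * w y = 1

/-- The magnitude of the finite set `X` with distance function `d` is defined (that is, a weighting
exists) and is equal to `m` (for whichever weighting it is computed from). -/
def HasMagnitude {X : Type u} [Fintype X] (d : X → X → ℝ) (m : ℝ) : Prop :=
  (∃ w, IsWeighting d w) ∧ ∀ w, IsWeighting d w → ∑ x, w x = m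

/-! ### Persistence modules and barcodes -/

/-- Persistence modules over `𝕜`: functors from the poset `(ℝ, ≤)` to `𝕜`-vector spaces. -/
abbrev PersistenceModule (𝕜 : Type v) [Field 𝕜] := ℝ ⥤ ModuleCat.{w} 𝕜

/-- Isomorphism of persistence modules, i.e. a family of linear isomorphisms commuting with all
structure maps (spelled out so that the vector spaces may live in different universes). -/
def PersistenceModule.Isomorphic {𝕜 : Type v} [Field 𝕜]
    (M : PersistenceModule.{v, w₁} 𝕜) (N : PersistenceModule.{v, w₂} 𝕜) : Prop :=
  ∃ e : ∀ x : ℝ, M.obj x ≃ₗ[𝕜] N.obj x,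
    ∀ (x y : ℝ) (f : x ⟶ y) (m : M.obj x), e y (M.map f m) = N.map f (e x m)

/-- The direct sum of a family of persistence modules. -/
def PersistenceModule.directSum {𝕜 : Type v} [Field 𝕜] {ι : Type w}
    (M : ι → PersistenceModule.{v, w₁} 𝕜) : PersistenceModule.{v, max w w₁} 𝕜 where
  obj x := ModuleCat.of 𝕜 (DirectSum ι fun i => (M i).obj x)
  map f := ModuleCat.ofHom (DirectSum.lmap fun i => ((M i).map f).hom)
  map_id x := by
    ext : 1
    simp only [CategoryTheory.Functor.map_id, ModuleCat.hom_id, ModuleCat.hom_ofHom]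
    exact DirectSum.lmap_id
  map_comp f g := by
    ext : 1
    simp only [CategoryTheory.Functor.map_comp, ModuleCat.hom_comp, ModuleCat.hom_ofHom]
    exact DirectSum.lmap_comp _ _

/-- For increasing families `B x ≤ Z x` of subspaces of a fixed space, the persistence module
`x ↦ Z x / B x`, whose structure maps are induced by the inclusions `Z x ≤ Z y`. -/
def PersistenceModule.subquotient {𝕜 : Type v} [Field 𝕜] {V : Type w} [AddCommGroup V]
    [Module 𝕜 V] (Z B : ℝ → Submodule 𝕜 V) (hZ : Monotone Z) (hB : Monotone B)
    (_hBZ : ∀ x, B x ≤ Z x) :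
    PersistenceModule.{v, w} 𝕜 where
  obj x := ModuleCat.of 𝕜 (Z x ⧸ (B x).submoduleOf (Z x))
  map {x y} f := ModuleCat.ofHom <|
    Submodule.mapQ ((B x).submoduleOf (Z x)) ((B y).submoduleOf (Z y))
      (Submodule.inclusion (hZ (leOfHom f))) (fun _ h => hB (leOfHom f) h)
  map_id x := by
    ext : 1
    apply Submodule.linearMap_qext
    rfl
  map_comp f g := by
    ext : 1
    apply Submodule.linearMap_qext
    rfl

/-- The half-open interval `[a, b)`, with `b` possibly infinite. -/
def bar (a : ℝ) (b : WithTop ℝ) : Set ℝ := {x | a ≤ x ∧ (x : WithTop ℝ) < b}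

/-- The value at `x` of the interval module on `J`: it is `𝕜` if `x ∈ J` and `0` otherwise. -/
def intervalFiber (𝕜 : Type v) [Field 𝕜] (J : Set ℝ) (x : ℝ) : Submodule 𝕜 𝕜 where
  carrier := {c | x ∉ J → c = 0}
  add_mem' h₁ h₂ hx := by rw [h₁ hx, h₂ hx, add_zero]
  zero_mem' _ := rfl
  smul_mem' c _ h hx := by rw [h hx, smul_zero]

open Classical in
/-- The structure map from `x` to `y` of the interval module on `J`: the identity of `𝕜` if both
`x` and `y` are in `J`, and `0` otherwise. -/
def intervalMap (𝕜 : Type v) [Field 𝕜] (J : Set ℝ) (x y : ℝ) :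
    intervalFiber 𝕜 J x →ₗ[𝕜] intervalFiber 𝕜 J y where
  toFun c := ⟨if x ∈ J ∧ y ∈ J then c else 0, fun hy => if_neg fun h => hy h.2⟩
  map_add' c c' := by
    ext
    by_cases h : x ∈ J ∧ y ∈ J <;> simp [h]
  map_smul' r c := by
    ext
    by_cases h : x ∈ J ∧ y ∈ J <;> simp [h]

/-- The interval module `𝕜[a, b)`. -/
def intervalModule (𝕜 : Type v) [Field 𝕜] (a : ℝ) (b : WithTop ℝ) :
    PersistenceModule.{v, v} 𝕜 where
  obj x := ModuleCat.of 𝕜 (intervalFiber 𝕜 (bar a b) x)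
  map {x y} _ := ModuleCat.ofHom (intervalMap 𝕜 (bar a b) x y)
  map_id x := by
    ext c
    by_cases h : x ∈ bar a b
    · simp [intervalMap, h]
    · simpa [intervalMap, h] using (c.2 h).symm
  map_comp {x y z} f g := by
    ext c
    by_cases hx : x ∈ bar a b
    · by_cases hz : z ∈ bar a b
      · have hy : y ∈ bar a b :=
          ⟨hx.1.trans (leOfHom f), (WithTop.coe_le_coe.2 (leOfHom g)).trans_lt hz.2⟩
        simp [intervalMap, hx, hy, hz]
      · simp [intervalMap, hz]
    · simp [intervalMap, hx]

/-- The (nonempty) intervals `[a i, b i)`, `i : ι`, are the bars of a barcode decomposition of `M`,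
counted with multiplicity: `M` is isomorphic to the direct sum of the interval modules
`𝕜[a i, b i)`. -/
def IsBarcode {𝕜 : Type v} [Field 𝕜] (M : PersistenceModule.{v, w₁} 𝕜) {ι : Type w}
    (a : ι → ℝ) (b : ι → WithTop ℝ) : Prop :=
  (∀ i, (a i : WithTop ℝ) < b i) ∧
    M.Isomorphic (PersistenceModule.directSum fun i => intervalModule 𝕜 (a i) (b i))

/-- `e^{-bt}`, with the convention `e^{-∞} = 0`. -/
def expNegMul (b : WithTop ℝ) (t : ℝ) : ℝ :=
  WithTop.recTopCoe (C := fun _ => ℝ) 0 (fun r => Real.exp (-(r * t))) b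

/-! ### Blurred magnitude homology -/

/-- No two consecutive entries of `(x₀, …, xₖ)` are equal. -/
def Nondegenerate {X : Type u} {k : ℕ} (x : Fin (k + 1) → X) : Prop :=
  ∀ i : Fin k, x i.castSucc ≠ x i.succ

/-- The tuples `(x₀, …, xₖ)` with consecutive entries distinct. -/
abbrev Tuple (X : Type u) (k : ℕ) := {x : Fin (k + 1) → X // Nondegenerate x}

/-- `ℓ(x₀, …, xₖ) = d(x₀, x₁) + ⋯ + d(xₖ₋₁, xₖ)`. -/
def length {X : Type u} [MetricSpace X] {k : ℕ} (x : Fin (k + 1) → X) : ℝ :=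
  ∑ i : Fin k, dist (x i.castSucc) (x i.succ)

open Classical in
/-- The basis element of a tuple, or `0` if two consecutive entries are equal. -/
def gen {X : Type u} (𝕜 : Type v) [Field 𝕜] {k : ℕ} (x : Fin (k + 1) → X) : Tuple X k →₀ 𝕜 :=
  if h : Nondegenerate x then Finsupp.single ⟨x, h⟩ 1 else 0

/-- The boundary operator
`∂(x₀, …, xₖ₊₁) = ∑ᵢ (-1)ⁱ (x₀, …, x̂ᵢ, …, xₖ₊₁)` on the union of all filtration stages, where
tuples with two equal consecutive entries count as `0`. -/
def boundary (X : Type u) (𝕜 : Type v) [Field 𝕜] (k : ℕ) :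
    (Tuple X (k + 1) →₀ 𝕜) →ₗ[𝕜] (Tuple X k →₀ 𝕜) :=
  Finsupp.linearCombination 𝕜 fun x : Tuple X (k + 1) =>
    ∑ i : Fin (k + 2), (-1 : 𝕜) ^ (i : ℕ) • gen 𝕜 (i.removeNth x.1)

/-- `BMC_k(X)(l)`: the vector space with basis the tuples `(x₀, …, xₖ)` with consecutive entries
distinct and length at most `l`. -/
def chains (X : Type u) [MetricSpace X] (𝕜 : Type v) [Field 𝕜] (k : ℕ) (l : ℝ) :
    Submodule 𝕜 (Tuple X k →₀ 𝕜) :=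
  Finsupp.supported 𝕜 𝕜 {x | length x.1 ≤ l}

/-- The `k`-cycles of `BMC_*(X)(l)`; every `0`-chain is a cycle. -/
def cycles (X : Type u) [MetricSpace X] (𝕜 : Type v) [Field 𝕜] :
    (k : ℕ) → (l : ℝ) → Submodule 𝕜 (Tuple X k →₀ 𝕜)
  | 0, l => chains X 𝕜 0 l
  | k + 1, l => chains X 𝕜 (k + 1) l ⊓ LinearMap.ker (boundary X 𝕜 k)

/-- The `k`-boundaries of `BMC_*(X)(l)`. -/
def boundaries (X : Type u) [MetricSpace X] (𝕜 : Type v) [Field 𝕜] (k : ℕ) (l : ℝ) :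
    Submodule 𝕜 (Tuple X k →₀ 𝕜) :=
  (chains X 𝕜 (k + 1) l).map (boundary X 𝕜 k)

theorem chains_mono (X : Type u) [MetricSpace X] (𝕜 : Type v) [Field 𝕜] (k : ℕ) :
    Monotone (chains X 𝕜 k) :=
  fun _ _ h => Finsupp.supported_mono fun _ hx => le_trans hx h

theorem cycles_mono (X : Type u) [MetricSpace X] (𝕜 : Type v) [Field 𝕜] (k : ℕ) :
    Monotone (cycles X 𝕜 k) := by
  intro l l' h
  cases k with
  | zero => exact chains_mono X 𝕜 0 h
  | succ k => exact inf_le_inf_right _ (chains_mono X 𝕜 (k + 1) h)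

theorem boundaries_mono (X : Type u) [MetricSpace X] (𝕜 : Type v) [Field 𝕜] (k : ℕ) :
    Monotone (boundaries X 𝕜 k) :=
  fun _ _ h => Submodule.map_mono (chains_mono X 𝕜 (k + 1) h)

theorem length_succ {X : Type u} [MetricSpace X] {k : ℕ} (x : Fin (k + 2) → X) :
    length x = dist (x 0) (x 1) + length (Fin.tail x) := by
  simp only [length, Fin.sum_univ_succ (n := k)]
  rfl

theorem length_nonneg {X : Type u} [MetricSpace X] {k : ℕ} (x : Fin (k + 1) → X) :
    0 ≤ length x := Finset.sum_nonneg fun _ _ => dist_nonneg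

theorem length_removeNth_le {X : Type u} [MetricSpace X] {k : ℕ} (x : Fin (k + 2) → X)
    (i : Fin (k + 2)) : length (i.removeNth x) ≤ length x := by
  induction k with
  | zero => simp [length]
  | succ k ih =>
    rw [length_succ x]
    induction i using Fin.cases with
    | zero => exact le_add_of_nonneg_left dist_nonneg
    | succ i =>
      have h : Fin.tail (i.succ.removeNth x) = i.removeNth (Fin.tail x) := by
        ext j
        simp [Fin.tail, Fin.removeNth]
      rw [length_succ, h]
      induction i using Fin.cases with
      | zero =>
        rw [length_succ (Fin.tail x), ← add_assoc]
        exact add_le_add (dist_triangle _ _ _) le_rfl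
      | succ i => exact add_le_add le_rfl (ih (Fin.tail x) i.succ)

theorem gen_mem_chains {X : Type u} [MetricSpace X] (𝕜 : Type v) [Field 𝕜] {k : ℕ}
    (x : Fin (k + 1) → X) {l : ℝ} (h : length x ≤ l) : gen 𝕜 x ∈ chains X 𝕜 k l := by
  unfold gen
  split_ifs with hx
  · exact Finsupp.single_mem_supported 𝕜 1 h
  · exact zero_mem _

/-- The boundary operator is compatible with the filtration. -/
theorem boundaries_le_chains (X : Type u) [MetricSpace X] (𝕜 : Type v) [Field 𝕜] (k : ℕ) (l : ℝ) :
    boundaries X 𝕜 k l ≤ chains X 𝕜 k l := by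
  rw [boundaries, chains, Finsupp.supported_eq_span_single, Submodule.map_span_le]
  rintro _ ⟨x, hx, rfl⟩
  simp only [boundary, Finsupp.linearCombination_single, one_smul]
  exact Submodule.sum_mem _ fun i _ => Submodule.smul_mem _ _
    (gen_mem_chains 𝕜 _ ((length_removeNth_le x.1 i).trans hx))

theorem boundary_gen (X : Type u) (𝕜 : Type v) [Field 𝕜] {k : ℕ} (x : Fin (k + 2) → X) :
    boundary X 𝕜 k (gen 𝕜 x) =
      ∑ i : Fin (k + 2), (-1 : 𝕜) ^ (i : ℕ) • gen 𝕜 (i.removeNth x) := by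
  by_cases hx : Nondegenerate x
  · simp [gen, hx, boundary]
  · rw [gen, dif_neg hx, map_zero]
    obtain ⟨j, hj⟩ : ∃ j : Fin (k + 1), x j.castSucc = x j.succ := by
      simpa [Nondegenerate] using hx
    have hne : j.castSucc ≠ j.succ := (Fin.castSucc_lt_succ).ne
    rw [Finset.sum_eq_add_of_mem j.castSucc j.succ (Finset.mem_univ _) (Finset.mem_univ _) hne]
    · have : j.castSucc.removeNth x = j.succ.removeNth x := by
        ext m
        simp only [Fin.removeNth]
        rcases lt_trichotomy m j with h | rfl | h
        · rw [Fin.succAbove_of_castSucc_lt _ _ (Fin.castSucc_lt_castSucc_iff.2 h),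
            Fin.succAbove_of_castSucc_lt _ _
              (by simp only [Fin.lt_def, Fin.val_castSucc, Fin.val_succ] at h ⊢; omega)]
        · simp [hj]
        · rw [Fin.succAbove_of_le_castSucc _ _ (Fin.castSucc_le_castSucc_iff.2 h.le),
            Fin.succAbove_of_le_castSucc _ _ (by simpa [Fin.le_def] using h)]
      rw [this]
      simp [pow_succ]
    · rintro i - ⟨h1, h2⟩
      rw [gen, dif_neg, smul_zero]
      have h1' : (i : ℕ) ≠ j := fun h => h1 (Fin.ext h)
      have h2' : (i : ℕ) ≠ j + 1 := fun h => h2 (Fin.ext h)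
      have hi := i.2
      have hj' := j.2
      intro hd
      rcases lt_or_gt_of_ne h1' with h | h
      · have e1 : i.succAbove (Fin.castSucc ⟨j - 1, by omega⟩ : Fin (k + 1)) = j.castSucc := by
          rw [Fin.succAbove_of_le_castSucc _ _ (by simp only [Fin.le_def, Fin.val_castSucc]; omega)]
          ext
          simp only [Fin.val_succ, Fin.val_castSucc]
          omega
        have e2 : i.succAbove (Fin.succ ⟨j - 1, by omega⟩ : Fin (k + 1)) = j.succ := by
          rw [Fin.succAbove_of_le_castSucc _ _
            (by simp only [Fin.le_def, Fin.val_castSucc, Fin.val_succ]; omega)]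
          ext
          simp only [Fin.val_succ]
          omega
        apply hd ⟨j - 1, by omega⟩
        rw [Fin.removeNth, Fin.removeNth, e1, e2, hj]
      · have e1 : i.succAbove (Fin.castSucc ⟨j, by omega⟩ : Fin (k + 1)) = j.castSucc := by
          rw [Fin.succAbove_of_castSucc_lt _ _ (by simp only [Fin.lt_def, Fin.val_castSucc]; omega)]
          rfl
        have e2 : i.succAbove (Fin.succ ⟨j, by omega⟩ : Fin (k + 1)) = j.succ := by
          rw [Fin.succAbove_of_castSucc_lt _ _
            (by simp only [Fin.lt_def, Fin.val_castSucc, Fin.val_succ]; omega)]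
          rfl
        apply hd ⟨j, by omega⟩
        rw [Fin.removeNth, Fin.removeNth, e1, e2, hj]

theorem removeNth_removeNth {X : Type u} {k : ℕ} (x : Fin (k + 3) → X) {i j : Fin (k + 2)}
    (h : i ≤ j) : i.removeNth (j.succ.removeNth x) = j.removeNth (i.castSucc.removeNth x) := by
  ext m
  simp only [Fin.removeNth]
  congr 1
  have := SimplexCategory.δ_comp_δ (n := k) h
  exact congrArg (fun f => SimplexCategory.Hom.toOrderHom f m) this

/-- `∂ ∘ ∂ = 0`. -/
theorem boundary_boundary (X : Type u) (𝕜 : Type v) [Field 𝕜] (k : ℕ) :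
    boundary X 𝕜 k ∘ₗ boundary X 𝕜 (k + 1) = 0 := by
  refine Finsupp.lhom_ext' fun x => LinearMap.ext_ring ?_
  have hx : Finsupp.single x (1 : 𝕜) = gen 𝕜 x.1 := by rw [gen, dif_pos x.2]
  simp only [LinearMap.comp_apply, Finsupp.lsingle_apply, LinearMap.zero_apply, hx, boundary_gen,
    map_sum, map_smul, Finset.smul_sum, smul_smul, ← pow_add]
  rw [← Finset.sum_product', Finset.univ_product_univ]
  let S : Finset (Fin (k + 3) × Fin (k + 2)) := {p | (p.1 : ℕ) ≤ (p.2 : ℕ)}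
  rw [← Finset.sum_add_sum_compl S, ← eq_neg_iff_add_eq_zero, ← Finset.sum_neg_distrib]
  let φ : ∀ p : Fin (k + 3) × Fin (k + 2), p ∈ S → Fin (k + 3) × Fin (k + 2) := fun p hp =>
    (p.2.succ, p.1.castLT (lt_of_le_of_lt (Finset.mem_filter.mp hp).right (Fin.is_lt p.2)))
  apply Finset.sum_bij φ
  · intro p hp
    simp_rw [S, φ, Finset.compl_filter, Finset.mem_filter_univ, Fin.val_succ,
      Fin.val_castLT] at hp ⊢
    lia
  · rintro ⟨i, j⟩ hij ⟨i', j'⟩ hij' h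
    simp only [φ, Prod.mk.injEq, Fin.ext_iff, Fin.val_castLT, Fin.val_succ] at h ⊢
    exact ⟨h.2, by lia⟩
  · rintro ⟨i', j'⟩ hij'
    simp_rw [S, Finset.compl_filter, Finset.mem_filter_univ, not_le] at hij'
    refine ⟨(Fin.castSucc j', i'.pred ?_), ?_, ?_⟩
    · rintro rfl
      simp only [Fin.val_zero, not_lt_zero] at hij'
    · simpa [S] using Nat.le_sub_one_of_lt hij'
    · simp only [φ, Fin.castLT_castSucc, Fin.succ_pred]
  · rintro ⟨i, j⟩ hij
    have hle : (i : ℕ) ≤ j := by simpa [S] using hij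
    have hi : (i.castLT (lt_of_le_of_lt hle j.2)).castSucc = i := Fin.castSucc_castLT _ _
    have := removeNth_removeNth x.1 (i := i.castLT (lt_of_le_of_lt hle j.2)) (j := j) hle
    rw [hi] at this
    simp only [φ, this, ← neg_smul, Fin.val_succ, Fin.val_castLT]
    congr 1
    ring

theorem boundaries_le_cycles (X : Type u) [MetricSpace X] (𝕜 : Type v) [Field 𝕜] (k : ℕ) (l : ℝ) :
    boundaries X 𝕜 k l ≤ cycles X 𝕜 k l := by
  cases k with
  | zero => exact boundaries_le_chains X 𝕜 0 l
  | succ k =>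
    refine le_inf (boundaries_le_chains X 𝕜 (k + 1) l) ?_
    rintro _ ⟨c, -, rfl⟩
    exact LinearMap.congr_fun (boundary_boundary X 𝕜 k) c

/-- The blurred magnitude homology `BMH_k(X)`: cycles modulo boundaries at each stage `l`, with
structure maps induced by the inclusions `BMC_k(X)(l) ⊆ BMC_k(X)(l')`. -/
def BMH (X : Type u) [MetricSpace X] (𝕜 : Type v) [Field 𝕜] (k : ℕ) :
    PersistenceModule.{v, max u v} 𝕜 :=
  PersistenceModule.subquotient (cycles X 𝕜 k) (boundaries X 𝕜 k)
    (cycles_mono X 𝕜 k) (boundaries_mono X 𝕜 k) (boundaries_le_cycles X 𝕜 k)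

end BlurredMagnitude

end

/-!
Draw a scale `L` at random from the exponential distribution of rate `t`, so that `L ≥ a` has
probability `e^{-at}` for `a ≥ 0`. Then a bar `[a, b)` with `a ≥ 0` contributes `e^{-at} - e^{-bt}`
to the expected dimension of homology at scale `L`, while a tuple `x` contributes `e^{-tℓ(x)}` to
the expected dimension of the chains. The rank–nullity relations between chains, cycles, boundaries
and homology survive taking expectations, so the right-hand side of the formula is the alternating
sum of the expected dimensions of the chain spaces. In degree `k` that dimension is `1ᵀ (ζ - 1)ᵏ 1`
for the matrix `ζ = (e^{-t d(x,y)})`, because expanding the power gives a sum over tuples. Once all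
row sums of `ζ` are less than `2`, the Neumann series `∑ (-1)ᵏ (ζ - 1)ᵏ = ζ⁻¹` converges, and
`1ᵀ ζ⁻¹ 1` is the magnitude.

Homology changes only at lengths of tuples, so every bar is born at one of these finitely many
lengths; this gives `a ≥ 0` and the finiteness of the barcode.
-/

noncomputable section

namespace BlurredMagnitude

open MeasureTheory ProbabilityTheory Filter Topology Matrix Module

section Barcode

variable {𝕜 : Type v} [Field 𝕜]

theorem intervalFiber_eq_top {J : Set ℝ} {x : ℝ} (hx : x ∈ J) : intervalFiber 𝕜 J x = ⊤ :=
  eq_top_iff.2 fun _ _ h => absurd hx h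

theorem intervalFiber_eq_bot {J : Set ℝ} {x : ℝ} (hx : x ∉ J) : intervalFiber 𝕜 J x = ⊥ :=
  eq_bot_iff.2 fun _ h => h hx

open Classical in
/-- The standard basis of the value at `x` of an interval module. It is indexed by the proofs of
`x ∈ J`, so that a single formula covers the one-dimensional and the zero fiber. -/
def intervalFiberBasis (J : Set ℝ) (x : ℝ) : Basis (PLift (x ∈ J)) 𝕜 (intervalFiber 𝕜 J x) :=
  if hx : x ∈ J then
    have : Unique (PLift (x ∈ J)) := { default := ⟨hx⟩, uniq := fun _ => rfl }
    (Basis.singleton _ 𝕜).map (LinearEquiv.ofTop _ (intervalFiber_eq_top hx)).symm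
  else
    have : IsEmpty (PLift (x ∈ J)) := ⟨fun h => hx h.down⟩
    have : Subsingleton (intervalFiber 𝕜 J x) :=
      Submodule.subsingleton_iff_eq_bot.2 (intervalFiber_eq_bot hx)
    Basis.empty _

theorem mem_of_surjective_intervalMap {J : Set ℝ} {x y : ℝ} (hy : y ∈ J)
    (h : Function.Surjective (intervalMap 𝕜 J x y)) : x ∈ J := by
  by_contra hx
  obtain ⟨c, hc⟩ := h ⟨1, fun hy' => absurd hy hy'⟩
  simpa [intervalMap, hx] using congrArg Subtype.val hc

theorem PersistenceModule.Isomorphic.surjective_map {M : PersistenceModule.{v, w₁} 𝕜}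
    {N : PersistenceModule.{v, w₂} 𝕜} (h : M.Isomorphic N) {x y : ℝ} {f : x ⟶ y}
    (hf : Function.Surjective (M.map f)) : Function.Surjective (N.map f) := by
  obtain ⟨e, he⟩ := h
  have hcomm : N.map f ∘ e x = e y ∘ M.map f := funext fun m => (he x y f m).symm
  exact .of_comp (hcomm ▸ (e y).surjective.comp hf)

namespace IsBarcode

variable {M : PersistenceModule.{v, w₁} 𝕜} {ι : Type w} {a : ι → ℝ} {b : ι → WithTop ℝ}

theorem nonempty_basis_obj (h : IsBarcode M a b) (x : ℝ) :
    Nonempty (Basis {i // x ∈ bar (a i) (b i)} 𝕜 (M.obj x)) := by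
  obtain ⟨-, e, -⟩ := h
  exact ⟨((DFinsupp.basis fun i => intervalFiberBasis (bar (a i) (b i)) x).reindex
    (Equiv.sigmaPLiftEquivSubtype _)).map (e x).symm⟩

theorem finrank_obj (h : IsBarcode M a b) (x : ℝ) :
    finrank 𝕜 (M.obj x) = Nat.card {i // x ∈ bar (a i) (b i)} :=
  let ⟨B⟩ := h.nonempty_basis_obj x
  finrank_eq_nat_card_basis B

theorem finite_setOf_mem_bar (h : IsBarcode M a b) (x : ℝ) [Module.Finite 𝕜 (M.obj x)] :
    {i | x ∈ bar (a i) (b i)}.Finite :=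
  let ⟨B⟩ := h.nonempty_basis_obj x
  Module.Finite.finite_basis B

theorem mem_bar_of_surjective_map (h : IsBarcode M a b) {x y : ℝ} {f : x ⟶ y}
    (hf : Function.Surjective (M.map f)) {i : ι} (hy : y ∈ bar (a i) (b i)) :
    x ∈ bar (a i) (b i) :=
  mem_of_surjective_intervalMap hy ((DirectSum.lmap_surjective _).1 (h.2.surjective_map hf) i)

end IsBarcode

end Barcode

section Subquotient

variable {𝕜 : Type v} [Field 𝕜] {V : Type w} [AddCommGroup V] [Module 𝕜 V]

theorem finrank_map_add_finrank_inf_ker {W : Type w₁} [AddCommGroup W] [Module 𝕜 W]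
    (f : V →ₗ[𝕜] W) (C : Submodule 𝕜 V) [Module.Finite 𝕜 C] :
    finrank 𝕜 (C.map f) + finrank 𝕜 (C ⊓ LinearMap.ker f : Submodule 𝕜 V) = finrank 𝕜 C := by
  rw [← LinearMap.finrank_range_add_finrank_ker (f.domRestrict C), LinearMap.range_domRestrict,
    LinearMap.ker_domRestrict, ← Submodule.finrank_map_subtype_eq C, Submodule.map_comap_subtype]

namespace PersistenceModule

variable {Z B : ℝ → Submodule 𝕜 V} (hZ : Monotone Z) (hB : Monotone B) (hBZ : ∀ x, B x ≤ Z x)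

theorem surjective_map_subquotient {x y : ℝ} (f : x ⟶ y) (h : Z y ≤ Z x) :
    Function.Surjective ((subquotient Z B hZ hB hBZ).map f) := by
  intro q
  obtain ⟨z, rfl⟩ := Submodule.Quotient.mk_surjective _ q
  exact ⟨Submodule.Quotient.mk ⟨z.1, h z.2⟩, rfl⟩

theorem finite_obj_subquotient (x : ℝ) [Module.Finite 𝕜 (Z x)] :
    Module.Finite 𝕜 ((subquotient Z B hZ hB hBZ).obj x) :=
  inferInstanceAs (Module.Finite 𝕜 (Z x ⧸ (B x).submoduleOf (Z x)))

theorem finrank_obj_subquotient_add (x : ℝ) [Module.Finite 𝕜 (Z x)] :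
    finrank 𝕜 ((subquotient Z B hZ hB hBZ).obj x) + finrank 𝕜 (B x) = finrank 𝕜 (Z x) := by
  rw [← Submodule.finrank_quotient_add_finrank ((B x).submoduleOf (Z x)),
    (Submodule.submoduleOfEquivOfLe (hBZ x)).finrank_eq]
  rfl

end PersistenceModule

end Subquotient

section Homology

variable {X : Type u} [MetricSpace X] {𝕜 : Type v} [Field 𝕜] {k : ℕ}

theorem finrank_chains (l : ℝ) :
    finrank 𝕜 (chains X 𝕜 k l) = Nat.card {x : Tuple X k // l ∈ bar (length x.1) ⊤} := by
  have hbar : {x : Tuple X k | length x.1 ≤ l} = {x | l ∈ bar (length x.1) ⊤} := by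
    ext x
    simp [bar]
  rw [chains, hbar]
  exact finrank_eq_nat_card_basis (Basis.ofRepr (Finsupp.supportedEquivFinsupp _))

theorem chains_le_chains {l l' : ℝ} (h : ∀ x : Tuple X k, length x.1 ≤ l' → length x.1 ≤ l) :
    chains X 𝕜 k l' ≤ chains X 𝕜 k l :=
  Finsupp.supported_mono h

theorem cycles_le_cycles {l l' : ℝ} (h : ∀ x : Tuple X k, length x.1 ≤ l' → length x.1 ≤ l) :
    cycles X 𝕜 k l' ≤ cycles X 𝕜 k l := by
  cases k with
  | zero => exact chains_le_chains h
  | succ k => exact inf_le_inf_right _ (chains_le_chains h)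

variable [Finite X]

instance finite_obj_BMH (l : ℝ) : Module.Finite 𝕜 ((BMH X 𝕜 k).obj l) :=
  PersistenceModule.finite_obj_subquotient _ _ _ l

theorem finrank_obj_BMH_add_finrank_boundaries (l : ℝ) :
    finrank 𝕜 ((BMH X 𝕜 k).obj l) + finrank 𝕜 (boundaries X 𝕜 k l) =
      finrank 𝕜 (cycles X 𝕜 k l) :=
  PersistenceModule.finrank_obj_subquotient_add _ _ _ l

theorem finrank_boundaries_add_finrank_cycles_succ (l : ℝ) :
    finrank 𝕜 (boundaries X 𝕜 k l) + finrank 𝕜 (cycles X 𝕜 (k + 1) l) =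
      finrank 𝕜 (chains X 𝕜 (k + 1) l) :=
  finrank_map_add_finrank_inf_ker _ _

namespace IsBarcode

variable {ι : Type w} {a : ι → ℝ} {b : ι → WithTop ℝ}

theorem mem_range_length_of_BMH (h : IsBarcode (BMH X 𝕜 k) a b) (i : ι) :
    a i ∈ Set.range fun x : Tuple X k => length x.1 := by
  by_contra hi
  obtain ⟨l, hl, hgap⟩ :
      ∃ l < a i, Set.Ioc l (a i) ⊆ (Set.range fun x : Tuple X k => length x.1)ᶜ :=
    exists_Ioc_subset_of_mem_nhds ((Set.finite_range _).isClosed.isOpen_compl.mem_nhds hi)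
      (exists_lt _)
  have hcycles : cycles X 𝕜 k (a i) ≤ cycles X 𝕜 k l :=
    cycles_le_cycles fun x hx => not_lt.1 fun hlx => hgap ⟨hlx, hx⟩ ⟨x, rfl⟩
  have hsurj : Function.Surjective ((BMH X 𝕜 k).map (homOfLE hl.le)) :=
    PersistenceModule.surjective_map_subquotient _ _ _ _ hcycles
  exact hl.not_ge (h.mem_bar_of_surjective_map hsurj ⟨le_rfl, h.1 i⟩).1

theorem nonneg_of_BMH (h : IsBarcode (BMH X 𝕜 k) a b) (i : ι) : 0 ≤ a i := by
  obtain ⟨x, hx⟩ := h.mem_range_length_of_BMH i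
  exact hx ▸ length_nonneg x.1

theorem finite_of_BMH (h : IsBarcode (BMH X 𝕜 k) a b) : Finite ι := by
  have hfin : (⋃ x : Tuple X k, {i | length x.1 ∈ bar (a i) (b i)}).Finite :=
    Set.finite_iUnion fun x => h.finite_setOf_mem_bar _
  refine Set.finite_univ_iff.1 (hfin.subset fun i _ => ?_)
  obtain ⟨x, hx⟩ := h.mem_range_length_of_BMH i
  exact Set.mem_iUnion.2 ⟨x, hx.ge, (congrArg _ hx).trans_lt (h.1 i)⟩

end IsBarcode

end Homology

section EulerCharacteristic

theorem integrable_finrank_of_monotone {α : Type u} [LinearOrder α] [TopologicalSpace α]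
    [OrderClosedTopology α] [MeasurableSpace α] [BorelSpace α] {μ : Measure α} [IsFiniteMeasure μ]
    {𝕜 : Type v} [Field 𝕜] {V : Type w} [AddCommGroup V] [Module 𝕜 V] [Module.Finite 𝕜 V]
    {F : α → Submodule 𝕜 V} (hF : Monotone F) :
    Integrable (fun l => (finrank 𝕜 (F l) : ℝ)) μ := by
  have hmono : Monotone fun l => (finrank 𝕜 (F l) : ℝ) :=
    fun _ _ h => Nat.cast_le.2 (Submodule.finrank_mono (hF h))
  refine .of_bound hmono.measurable.aestronglyMeasurable (finrank 𝕜 V) (.of_forall fun l => ?_)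
  simpa using (F l).finrank_le

-- `c`, `z`, `b`, `h` stand for the dimensions of chains, cycles, boundaries and homology. There is
-- no top degree: `b ≤ c` is what makes the boundary terms summable, so that they cancel.
theorem hasSum_neg_one_pow_mul_of_add_eq {c z b h : ℕ → ℝ} {m : ℝ} (hb : ∀ k, 0 ≤ b k)
    (hbc : ∀ k, b k ≤ c k) (hz₀ : z 0 = c 0) (hbz : ∀ k, b k + z (k + 1) = c (k + 1))
    (hhb : ∀ k, h k + b k = z k) (hc : HasSum (fun k => (-1) ^ k * c k) m) :
    HasSum (fun k => (-1) ^ k * h k) m := by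
  have hb_sum : HasSum (fun k => (-1) ^ k * b k) (∑' k, (-1) ^ k * b k) := by
    refine (Summable.of_norm_bounded hc.summable.norm fun k => ?_).hasSum
    simpa [abs_of_nonneg, hb k, (hb k).trans (hbc k)] using hbc k
  have hz_sum : HasSum (fun k => (-1) ^ k * z k) (m + ∑' k, (-1) ^ k * b k) := by
    rw [← hasSum_nat_add_iff' 1]
    convert ((hasSum_nat_add_iff' 1).2 hc).add hb_sum using 1
    · ext k
      rw [← hbz k]
      ring
    · simp only [Finset.sum_range_one, pow_zero, one_mul, hz₀]
      ring
  have hh : (fun k => (-1) ^ k * h k) = fun k => (-1) ^ k * z k - (-1) ^ k * b k := by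
    ext k
    rw [← hhb k]
    ring
  simpa only [hh, add_sub_cancel_right] using hz_sum.sub hb_sum

variable {X : Type u} [MetricSpace X] [Finite X] {𝕜 : Type v} [Field 𝕜]

theorem integral_finrank_obj_BMH_add (μ : Measure ℝ) [IsFiniteMeasure μ] (k : ℕ) :
    (∫ l, (finrank 𝕜 ((BMH X 𝕜 k).obj l) : ℝ) ∂μ) + ∫ l, (finrank 𝕜 (boundaries X 𝕜 k l) : ℝ) ∂μ =
      ∫ l, (finrank 𝕜 (cycles X 𝕜 k l) : ℝ) ∂μ := by
  have hBMH (l : ℝ) : (finrank 𝕜 ((BMH X 𝕜 k).obj l) : ℝ) =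
      finrank 𝕜 (cycles X 𝕜 k l) - finrank 𝕜 (boundaries X 𝕜 k l) :=
    eq_sub_of_add_eq (by exact_mod_cast finrank_obj_BMH_add_finrank_boundaries l)
  simp_rw [hBMH]
  rw [integral_sub (integrable_finrank_of_monotone (cycles_mono X 𝕜 k))
    (integrable_finrank_of_monotone (boundaries_mono X 𝕜 k)), sub_add_cancel]

theorem integral_finrank_boundaries_add (μ : Measure ℝ) [IsFiniteMeasure μ] (k : ℕ) :
    (∫ l, (finrank 𝕜 (boundaries X 𝕜 k l) : ℝ) ∂μ) +
        ∫ l, (finrank 𝕜 (cycles X 𝕜 (k + 1) l) : ℝ) ∂μ =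
      ∫ l, (finrank 𝕜 (chains X 𝕜 (k + 1) l) : ℝ) ∂μ := by
  rw [← integral_add (integrable_finrank_of_monotone (boundaries_mono X 𝕜 k))
    (integrable_finrank_of_monotone (cycles_mono X 𝕜 (k + 1)))]
  exact_mod_cast congrArg (fun f : ℝ → ℕ => ∫ l, (f l : ℝ) ∂μ)
    (funext fun l => finrank_boundaries_add_finrank_cycles_succ l)

theorem hasSum_integral_finrank_BMH {μ : Measure ℝ} [IsFiniteMeasure μ] {m : ℝ}
    (h : HasSum (fun k => (-1) ^ k * ∫ l, (finrank 𝕜 (chains X 𝕜 k l) : ℝ) ∂μ) m) :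
    HasSum (fun k => (-1) ^ k * ∫ l, (finrank 𝕜 ((BMH X 𝕜 k).obj l) : ℝ) ∂μ) m := by
  refine hasSum_neg_one_pow_mul_of_add_eq
    (z := fun k => ∫ l, (finrank 𝕜 (cycles X 𝕜 k l) : ℝ) ∂μ)
    (fun k => integral_nonneg fun l => Nat.cast_nonneg _) (fun k => ?_) rfl
    (integral_finrank_boundaries_add μ) (integral_finrank_obj_BMH_add μ) h
  exact integral_mono (integrable_finrank_of_monotone (boundaries_mono X 𝕜 k))
    (integrable_finrank_of_monotone (chains_mono X 𝕜 k))
    fun l => Nat.cast_le.2 (Submodule.finrank_mono (boundaries_le_chains X 𝕜 k l))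

end EulerCharacteristic

section ExponentialScale

theorem integral_natCard_mem {α : Type u} [MeasurableSpace α] {μ : Measure α} [IsFiniteMeasure μ]
    {ι : Type w} [Fintype ι] {J : ι → Set α} (hJ : ∀ i, MeasurableSet (J i)) :
    ∫ x, (Nat.card {i // x ∈ J i} : ℝ) ∂μ = ∑ i, μ.real (J i) := by
  classical
  have hcard (x : α) : (Nat.card {i // x ∈ J i} : ℝ) = ∑ i, (J i).indicator 1 x := by
    simp [Nat.card_eq_fintype_card, Fintype.card_subtype, Set.indicator_apply]
  simp_rw [hcard]
  rw [integral_finsetSum _ fun i _ => (integrable_const 1).indicator (hJ i)]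
  exact Finset.sum_congr rfl fun i _ => integral_indicator_one (hJ i)

theorem bar_top (a : ℝ) : bar a ⊤ = Set.Ici a := by
  ext x
  simp [bar]

theorem bar_coe (a b : ℝ) : bar a b = Set.Ico a b := by
  ext x
  simp [bar]

theorem measureReal_expMeasure_Ici {t a : ℝ} (ht : 0 < t) (ha : 0 ≤ a) :
    (expMeasure t).real (Set.Ici a) = Real.exp (-(a * t)) := by
  have := isProbabilityMeasure_expMeasure ht
  have hatom : expMeasure t {a} = 0 := withDensity_absolutelyContinuous _ _ (measure_singleton a)
  rw [← Set.compl_Iio, probReal_compl_eq_one_sub measurableSet_Iio,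
    measureReal_congr (Iio_ae_eq_Iic' hatom), ← cdf_eq_real, cdf_expMeasure_eq ht, if_pos ha,
    mul_comm]
  ring

theorem measurableSet_bar (a : ℝ) (b : WithTop ℝ) : MeasurableSet (bar a b) := by
  induction b using WithTop.recTopCoe with
  | top => exact bar_top a ▸ measurableSet_Ici
  | coe b => exact bar_coe a b ▸ measurableSet_Ico

theorem measureReal_expMeasure_bar {t a : ℝ} (ht : 0 < t) (ha : 0 ≤ a) {b : WithTop ℝ}
    (hab : (a : WithTop ℝ) < b) :
    (expMeasure t).real (bar a b) = Real.exp (-(a * t)) - expNegMul b t := by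
  have := isProbabilityMeasure_expMeasure ht
  induction b using WithTop.recTopCoe with
  | top =>
    rw [bar_top, measureReal_expMeasure_Ici ht ha, expNegMul, WithTop.recTopCoe_top, sub_zero]
  | coe b =>
    have hab' : a ≤ b := WithTop.coe_le_coe.1 hab.le
    rw [bar_coe, ← Set.Ici_sdiff_Ici,
      measureReal_sdiff (Set.Ici_subset_Ici.2 hab') measurableSet_Ici,
      measureReal_expMeasure_Ici ht ha, measureReal_expMeasure_Ici ht (ha.trans hab'), expNegMul,
      WithTop.recTopCoe_coe]

theorem integral_natCard_mem_bar {t : ℝ} (ht : 0 < t) {ι : Type w} [Fintype ι] {a : ι → ℝ}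
    {b : ι → WithTop ℝ} (ha : ∀ i, 0 ≤ a i) (hab : ∀ i, (a i : WithTop ℝ) < b i) :
    ∫ l, (Nat.card {i // l ∈ bar (a i) (b i)} : ℝ) ∂expMeasure t =
      ∑ i, (Real.exp (-(a i * t)) - expNegMul (b i) t) := by
  have := isProbabilityMeasure_expMeasure ht
  rw [integral_natCard_mem fun i => measurableSet_bar _ _]
  exact Finset.sum_congr rfl fun i _ => measureReal_expMeasure_bar ht (ha i) (hab i)

end ExponentialScale

section Magnitude

theorem dotProduct_pow_mulVec {R : Type v} [CommSemiring R] {n : Type u} [Fintype n]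
    [DecidableEq n] (A : Matrix n n R) (k : ℕ) (v w : n → R) :
    v ⬝ᵥ (A ^ k *ᵥ w) = ∑ x : Fin (k + 1) → n,
      v (x 0) * (∏ i : Fin k, A (x i.castSucc) (x i.succ)) * w (x (Fin.last k)) := by
  induction k generalizing v with
  | zero =>
    rw [← (Equiv.funUnique (Fin 1) n).symm.sum_comp]
    simp [dotProduct]
  | succ k ih =>
    rw [pow_succ', ← mulVec_mulVec, dotProduct_mulVec, ih,
      ← (Fin.consEquiv fun _ : Fin (k + 2) => n).sum_comp, Fintype.sum_prod_type_right]
    refine Finset.sum_congr rfl fun x _ => ?_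
    simp only [vecMul, dotProduct, Finset.sum_mul]
    refine Finset.sum_congr rfl fun y _ => ?_
    simp [Fin.consEquiv, Fin.prod_univ_succ, ← Fin.succ_last, mul_assoc]

open scoped Matrix.Norms.Operator in
theorem hasSum_neg_one_pow_mul_dotProduct_pow_mulVec {R : Type v} [NormedCommRing R]
    [CompleteSpace R] {n : Type u} [Fintype n] [DecidableEq n] {A : Matrix n n R} (hA : ‖A‖ < 1)
    (v w : n → R) :
    HasSum (fun k => (-1) ^ k * (v ⬝ᵥ (A ^ k *ᵥ w))) (v ⬝ᵥ ((1 + A)⁻¹ *ᵥ w)) := by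
  have : @CompleteSpace (Matrix n n R) PseudoMetricSpace.toUniformSpace :=
    inferInstanceAs (CompleteSpace (n → n → R))
  have hinv : HasSum (fun k => (-A) ^ k) (1 + A)⁻¹ := by
    rw [← sub_neg_eq_add 1 A, nonsing_inv_eq_ringInverse]
    exact hasSum_geom_series_inverse (-A) ((norm_neg A).trans_lt hA)
  have hcont : Continuous fun M : Matrix n n R => v ⬝ᵥ (M *ᵥ w) := by fun_prop
  let φ : Matrix n n R →+ R :=
    { toFun := fun M => v ⬝ᵥ (M *ᵥ w)
      map_zero' := by simp
      map_add' := fun M N => by simp [add_mulVec] }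
  convert hinv.map φ hcont using 2 with k
  · rcases k.even_or_odd with hk | hk <;> simp [φ, hk.neg_pow, neg_mulVec]
  · rfl

variable {X : Type u}

/-- The matrix `e^{-d(x,y)}` of a distance function; weightings are the preimages of the constant
vector `1` under it. -/
def similarityMatrix (d : X → X → ℝ) : Matrix X X ℝ := .of fun x y => Real.exp (-d x y)

variable [Fintype X] [DecidableEq X] {d : X → X → ℝ}

theorem hasMagnitude_of_isUnit (h : IsUnit (similarityMatrix d)) :
    HasMagnitude d (1 ⬝ᵥ ((similarityMatrix d)⁻¹ *ᵥ 1)) := by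
  have hdet := (isUnit_iff_isUnit_det _).1 h
  refine ⟨⟨(similarityMatrix d)⁻¹ *ᵥ 1, fun x => ?_⟩, fun w hw => ?_⟩
  · have hmul : similarityMatrix d *ᵥ ((similarityMatrix d)⁻¹ *ᵥ 1) = 1 := by
      rw [mulVec_mulVec, mul_nonsing_inv _ hdet, one_mulVec]
    exact congrFun hmul x
  · have hw' : similarityMatrix d *ᵥ w = 1 := funext hw
    have hw_eq : (similarityMatrix d)⁻¹ *ᵥ 1 = w := by
      rw [← hw', mulVec_mulVec, nonsing_inv_mul _ hdet, one_mulVec]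
    rw [hw_eq, one_dotProduct]

open scoped Matrix.Norms.Operator in
theorem norm_similarityMatrix_sub_one_lt_one (hd : ∀ x, d x x = 0)
    (h : ∀ x, ∑ y, Real.exp (-d x y) < 2) : ‖similarityMatrix d - 1‖ < 1 := by
  have hnonneg (x y : X) : 0 ≤ (similarityMatrix d - 1) x y := by
    by_cases hxy : x = y <;> simp [similarityMatrix, one_apply, hxy, hd, Real.exp_nonneg]
  rw [linfty_opNorm_def, ← NNReal.coe_one, NNReal.coe_lt_coe, Finset.sup_lt_iff one_pos]
  intro x _
  rw [← NNReal.coe_lt_coe]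
  calc ((∑ y, ‖(similarityMatrix d - 1) x y‖₊ : NNReal) : ℝ)
      = ∑ y, (Real.exp (-d x y) - (1 : Matrix X X ℝ) x y) := by
        push_cast
        exact Finset.sum_congr rfl fun y _ => abs_of_nonneg (hnonneg x y)
    _ = ∑ y, Real.exp (-d x y) - 1 := by simp [one_apply]
    _ < (1 : NNReal) := by
        have := h x
        push_cast
        linarith

theorem exists_hasMagnitude_hasSum (hd : ∀ x, d x x = 0) (h : ∀ x, ∑ y, Real.exp (-d x y) < 2) :
    ∃ m, HasMagnitude d m ∧
      HasSum (fun k => (-1) ^ k * (1 ⬝ᵥ ((similarityMatrix d - 1) ^ k *ᵥ 1))) m := by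
  open scoped Matrix.Norms.Operator in
  have hnorm := norm_similarityMatrix_sub_one_lt_one hd h
  have hunit : IsUnit (similarityMatrix d) := by
    simpa only [sub_sub_cancel] using
      isUnit_one_sub_of_norm_lt_one ((norm_sub_rev 1 (similarityMatrix d)).trans_lt hnorm)
  refine ⟨_, hasMagnitude_of_isUnit hunit, ?_⟩
  simpa using hasSum_neg_one_pow_mul_dotProduct_pow_mulVec hnorm 1 1

end Magnitude

section Tuples

variable {X : Type u} [MetricSpace X]

theorem prod_similarityMatrix_sub_one [DecidableEq X] (t : ℝ) {k : ℕ} (x : Fin (k + 1) → X)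
    [Decidable (Nondegenerate x)] :
    ∏ i : Fin k, (similarityMatrix (fun x y : X => t * dist x y) - 1) (x i.castSucc) (x i.succ) =
      if Nondegenerate x then Real.exp (-(length x * t)) else 0 := by
  split_ifs with hx
  · rw [length, Finset.sum_mul, ← Finset.sum_neg_distrib, Real.exp_sum]
    refine Finset.prod_congr rfl fun i _ => ?_
    simp [similarityMatrix, one_apply_ne (hx i), mul_comm]
  · obtain ⟨j, hj⟩ : ∃ j : Fin k, x j.castSucc = x j.succ := by simpa [Nondegenerate] using hx
    exact Finset.prod_eq_zero (Finset.mem_univ j) (by simp [similarityMatrix, hj])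

theorem sum_exp_neg_length_mul [Fintype X] [DecidableEq X] (t : ℝ) (k : ℕ) [Fintype (Tuple X k)] :
    ∑ x : Tuple X k, Real.exp (-(length x.1 * t)) =
      1 ⬝ᵥ ((similarityMatrix (fun x y : X => t * dist x y) - 1) ^ k *ᵥ 1) := by
  classical
  simp_rw [dotProduct_pow_mulVec, Pi.one_apply, one_mul, mul_one, prod_similarityMatrix_sub_one]
  rw [← Finset.sum_filter, Finset.sum_subtype (p := Nondegenerate) _ (by simp)]

theorem integral_finrank_chains [Fintype X] [DecidableEq X] (𝕜 : Type v) [Field 𝕜] {t : ℝ}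
    (ht : 0 < t) (k : ℕ) :
    ∫ l, (finrank 𝕜 (chains X 𝕜 k l) : ℝ) ∂expMeasure t =
      1 ⬝ᵥ ((similarityMatrix (fun x y : X => t * dist x y) - 1) ^ k *ᵥ 1) := by
  have := Fintype.ofFinite (Tuple X k)
  simp_rw [finrank_chains]
  rw [integral_natCard_mem_bar (b := fun _ : Tuple X k => ⊤) ht (fun x => length_nonneg x.1)
    fun x => WithTop.coe_lt_top _, ← sum_exp_neg_length_mul]
  simp [expNegMul]

theorem IsBarcode.integral_finrank_obj {𝕜 : Type v} [Field 𝕜] {M : PersistenceModule.{v, w₁} 𝕜}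
    {ι : Type w} [Finite ι] {a : ι → ℝ} {b : ι → WithTop ℝ} (h : IsBarcode M a b)
    (ha : ∀ i, 0 ≤ a i) {t : ℝ} (ht : 0 < t) :
    ∫ l, (finrank 𝕜 (M.obj l) : ℝ) ∂expMeasure t =
      ∑' i, (Real.exp (-(a i * t)) - expNegMul (b i) t) := by
  have := Fintype.ofFinite ι
  simp_rw [h.finrank_obj]
  rw [integral_natCard_mem_bar ht ha h.1, tsum_fintype]

theorem eventually_sum_exp_neg_mul_dist_lt_two [Fintype X] :
    ∀ᶠ t : ℝ in atTop, ∀ x : X, ∑ y, Real.exp (-(t * dist x y)) < 2 := by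
  classical
  refine eventually_all.2 fun x => ?_
  have hterm (y : X) : Tendsto (fun t : ℝ => Real.exp (-(t * dist x y))) atTop
      (𝓝 (if x = y then 1 else 0)) := by
    split_ifs with hxy
    · simp [hxy]
    · exact Real.tendsto_exp_neg_atTop_nhds_zero.comp
        (tendsto_id.atTop_mul_const (dist_pos.2 hxy))
  have hsum := tendsto_finsetSum Finset.univ fun y _ => hterm y
  exact hsum.eventually_lt_const (by simp)

end Tuples

end BlurredMagnitude

end

open BlurredMagnitude in
theorem mainTheorem1_general {X : Type u} [MetricSpace X] [Fintype X] {𝕜 : Type v} [Field 𝕜]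
    {ι : ℕ → Type w} {a : ∀ k, ι k → ℝ} {b : ∀ k, ι k → WithTop ℝ}
    (h : ∀ k, IsBarcode (BMH X 𝕜 k) (a k) (b k)) :
    (∀ k, Finite (ι k)) ∧
      ∀ t : ℝ, 0 < t → (∀ x : X, ∑ y, Real.exp (-(t * dist x y)) < 2) →
        ∃ m : ℝ, HasMagnitude (fun x y : X => t * dist x y) m ∧
          HasSum (fun k : ℕ => ∑' i : ι k,
            (-1 : ℝ) ^ k * (Real.exp (-(a k i * t)) - expNegMul (b k i) t)) m := by
  classical
  have hfin k : Finite (ι k) := (h k).finite_of_BMH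
  refine ⟨hfin, fun t ht hX => ?_⟩
  have := ProbabilityTheory.isProbabilityMeasure_expMeasure ht
  obtain ⟨m, hmagnitude, hsum⟩ :=
    exists_hasMagnitude_hasSum (d := fun x y : X => t * dist x y) (by simp) hX
  refine ⟨m, hmagnitude, ?_⟩
  simp_rw [← integral_finrank_chains 𝕜 ht] at hsum
  simp_rw [tsum_mul_left, ← (h _).integral_finrank_obj (h _).nonneg_of_BMH ht]
  exact hasSum_integral_finrank_BMH hsum

theorem mainTheorem1 {X : Type u} [MetricSpace X] [Fintype X] (𝕜 : Type v) [Field 𝕜] :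
    ∃ T : ℝ, 0 < T ∧
      ∀ (ι : ℕ → Type w) (a : ∀ k, ι k → ℝ) (b : ∀ k, ι k → WithTop ℝ),
        (∀ k, BlurredMagnitude.IsBarcode (BlurredMagnitude.BMH X 𝕜 k) (a k) (b k)) →
        (∀ k, Finite (ι k)) ∧
        ∀ t : ℝ, T < t →
          ∃ m : ℝ,
            BlurredMagnitude.HasMagnitude (fun x y : X => t * dist x y) m ∧
            HasSum
              (fun k : ℕ => ∑' i : ι k,
                (-1 : ℝ) ^ k *
                  (Real.exp (-(a k i * t)) - BlurredMagnitude.expNegMul (b k i) t))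
              m := by
  obtain ⟨T, hT⟩ := Filter.eventually_atTop.1 ((Filter.eventually_gt_atTop 0).and
    (BlurredMagnitude.eventually_sum_exp_neg_mul_dist_lt_two (X := X)))
  exact ⟨T, (hT T le_rfl).1, fun ι a b h => (mainTheorem1_general h).imp_right fun hmain t ht =>
    hmain t (hT t ht.le).1 (hT t ht.le).2⟩
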